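/- Let $f:\mathbb R^{n}\times\mathbb R^{p}\to\mathbb R^{n}$ be smooth, let $\mathcal V=L^\infty([0,1],\mathbb R^p)$, and assume that for every $u\in\mathcal V$ and $x\in\mathbb R^n$ the system $\dot x(t)=f(x(t),u(t))$, $x(0)=x$, has a (Carathéodory) solution $t\mapsto\varphi_t(u,x)$ on $[0,1]$; write $\varphi=\varphi_1$. Let $R:\mathbb R^n\to\mathbb R^{m}$ be linear and surjective. Let $x^1,\dots,x^q\in\mathbb R^n$ be pairwise distinct, let $y^1,\dots,y^q\in\mathbb R^m$, and for $x\in\mathbb R^n$, $y\in\mathbb R^m$ set $U(x,y)=\{u\in\mathcal V: R(\varphi(u,x))=y\}$. For $u\in\mathcal V$ and $x\in\mathbb R^n$ put $A(t)=\frac{\partial f}{\partial x}(\varphi_t(u,x),u(t))$ and $B(t)=\frac{\partial f}{\partial u}(\varphi_t(u,x),u(t))$, let $\Phi_{(u,x)}(t,\tau)$ be the state transition matrix of $\dot z=A(t)z$, and set $$\mathcal L_{(u,x)}(v)=\int_0^1\Phi_{(u,x)}(1,\tau)B(\tau)v(\tau)\,d\tau,\qquad \ker(u,x)=\{v\in\mathcal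 V: R(\mathcal L_{(u,x)}(v))=0\}.$$ The tangent space $T_uS$ of a set $S\subseteq\mathcal V$ at $u\in S$ is the set of velocities at $u$ of $C^1$ curves in $S$ through $u$. Assume: 1. (Bracket generation) the vector fields $(a_1,\dots,a_q)\mapsto(f(a_1,c),\dots,f(a_q,c))$, $c\in\mathbb R^p$, are bracket-generating at every $q$-tuple of pairwise distinct points of $\mathbb R^n$; 2. (Linearized controllability) for every $i$ and every $u\in U(x^i,y^i)$ the linear time-varying system $\dot z=A(t)z+B(t)v$ along $t\mapsto\varphi_t(u,x^i)$ is controllable on $[0,1]$ with inputs $v\in\mathcal V$; 3. (Strong memorization of degree $q$) for all pairwise distinct $\tilde x^1,\dots,\tilde x^q\in\mathbb R^n$ and all $\tilde y^1,\dots,\tilde y^q\in\mathbb R^m$, the sets $U_i=U(\tilde x^i,\tilde y^i)$ have a common element and intersect transversally, i.e. $T_uU_i+\bigcap_{l\ne i}T_uU_l=\mathcal V$ for every $u\in\bigcap_l U_l$ and every $i$. Then: (a) for every $i$ and every $u\in U(x^i,y^i)$, the set $U(x^i,y^i)$ is a smooth Banach submanifold of $\mathcal V$ near $u$, and $T_uU(x^i,y^i)=\ker(u,x^i)$;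 (b) for every $j\le q$ and every $u\in\bigcap_{i=1}^jU(x^i,y^i)$, the set $\bigcap_{i=1}^jU(x^i,y^i)$ is a smooth Banach submanifold of $\mathcal V$ near $u$, and $$T_u\Big(\bigcap_{i=1}^jU(x^i,y^i)\Big)=\bigcap_{i=1}^j\ker(u,x^i)=:\ker(u,\mathcal X^j),\qquad \mathcal X^j=\{x^1,\dots,x^j\}.$$ -/

import Mathlib

open MeasureTheory Set Filter Topology
open scoped ContDiff ENNReal

noncomputable section

namespace NeuralODE

/-- Euclidean space `ℝ^n`. -/
abbrev Eu (n : ℕ) : Type := EuclideanSpace ℝ (Fin n)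

/-- The Banach space of controls `L^∞([0,1], ℝ^p)`. -/
abbrev Control (p : ℕ) : Type := Lp (Eu p) ∞ ((volume : Measure ℝ).restrict (Icc (0 : ℝ) 1))

/-! ### Trajectories, flow and end-point sets -/

/-- `ξ` is a (Carathéodory) solution on `[0,1]` of `ẋ(t) = f(x(t), u(t))`, `x(0) = x₀`. -/
def IsTrajectory {n p : ℕ} (f : Eu n → Eu p → Eu n) (u : Control p) (x₀ : Eu n)
    (ξ : ℝ → Eu n) : Prop :=
  ContinuousOn ξ (Icc 0 1) ∧
    ∀ t ∈ Icc (0 : ℝ) 1, ξ t = x₀ + ∫ s in (0 : ℝ)..t, f (ξ s) (u s)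

/-- Every control and every initial state admit a solution on the whole of `[0,1]`,
so that the flow is defined on `L^∞([0,1], ℝ^p) × ℝ^n`. -/
def HasFlow {n p : ℕ} (f : Eu n → Eu p → Eu n) : Prop :=
  ∀ (u : Control p) (x₀ : Eu n), ∃ ξ, IsTrajectory f u x₀ ξ

/-- The flow `φ_t(u, x₀)`: the value at time `t ∈ [0,1]` of the solution
(unique on `[0,1]` for smooth `f`) with control `u` and initial state `x₀`. -/
def flow {n p : ℕ} (f : Eu n → Eu p → Eu n) (u : Control p) (x₀ : Eu n) : ℝ → Eu n :=
  Classical.epsilon fun ξ => IsTrajectory f u x₀ ξ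

/-- `U(x, y)`: the controls that steer `x`, at time `1`, into `R⁻¹(y)`. -/
def controlSet {n p m : ℕ} (f : Eu n → Eu p → Eu n) (R : Eu n →L[ℝ] Eu m)
    (x : Eu n) (y : Eu m) : Set (Control p) :=
  {u | R (flow f u x 1) = y}

/-! ### Linearization along a trajectory -/

/-- `A(t) = ∂f/∂x` at `(φ_t(u, x), u(t))`. -/
def linA {n p : ℕ} (f : Eu n → Eu p → Eu n) (u : Control p) (x : Eu n) (t : ℝ) :
    Eu n →L[ℝ] Eu n :=
  fderiv ℝ (fun a => f a (u t)) (flow f u x t)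

/-- `B(t) = ∂f/∂u` at `(φ_t(u, x), u(t))`. -/
def linB {n p : ℕ} (f : Eu n → Eu p → Eu n) (u : Control p) (x : Eu n) (t : ℝ) :
    Eu p →L[ℝ] Eu n :=
  fderiv ℝ (fun c => f (flow f u x t) c) (u t)

/-- `z` solves `ż = A z + B v`, `z(0) = z₀`, on `[0,1]`. -/
def IsLinTrajectory {n p : ℕ} (f : Eu n → Eu p → Eu n) (u : Control p) (x : Eu n)
    (v : Control p) (z₀ : Eu n) (z : ℝ → Eu n) : Prop :=
  ContinuousOn z (Icc 0 1) ∧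
    ∀ t ∈ Icc (0 : ℝ) 1,
      z t = z₀ + ∫ s in (0 : ℝ)..t, (linA f u x s (z s) + linB f u x s (v s))

/-- The linear time-varying system `ż = A z + B v` is controllable on `[0,1]`. -/
def LinControllable {n p : ℕ} (f : Eu n → Eu p → Eu n) (u : Control p) (x : Eu n) : Prop :=
  ∀ z₀ z₁ : Eu n, ∃ (v : Control p) (z : ℝ → Eu n), IsLinTrajectory f u x v z₀ z ∧ z 1 = z₁

/-- Linearized controllability property at `x` (with target `y`). -/
def LCP {n p m : ℕ} (f : Eu n → Eu p → Eu n) (R : Eu n →L[ℝ] Eu m)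
    (x : Eu n) (y : Eu m) : Prop :=
  ∀ u ∈ controlSet f R x y, LinControllable f u x

/-- `Ψ = Φ(·, τ)` solves `∂ₜ Φ(t, τ) = A(t) Φ(t, τ)`, `Φ(τ, τ) = 1`, on `[0,1]`. -/
def IsTransition {n p : ℕ} (f : Eu n → Eu p → Eu n) (u : Control p) (x : Eu n) (τ : ℝ)
    (Ψ : ℝ → Eu n →L[ℝ] Eu n) : Prop :=
  ContinuousOn Ψ (Icc 0 1) ∧
    ∀ t ∈ Icc (0 : ℝ) 1,
      Ψ t = ContinuousLinearMap.id ℝ (Eu n) + ∫ s in τ..t, (linA f u x s).comp (Ψ s)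

/-- The state transition matrix `Φ_{(u,x)}(t, τ)`, for `t, τ ∈ [0,1]`. -/
def transition {n p : ℕ} (f : Eu n → Eu p → Eu n) (u : Control p) (x : Eu n) (t τ : ℝ) :
    Eu n →L[ℝ] Eu n :=
  Classical.epsilon (fun Ψ => IsTransition f u x τ Ψ) t

/-- The linearized end-point operator
`L_{(u,x)}(v) = ∫₀¹ Φ_{(u,x)}(1, τ) B(τ) v(τ) dτ`. -/
def linEndpoint {n p : ℕ} (f : Eu n → Eu p → Eu n) (u : Control p) (x : Eu n)
    (v : Control p) : Eu n :=
  ∫ τ in (0 : ℝ)..1, transition f u x 1 τ (linB f u x τ (v τ))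

/-- `ker(u, x)`: the kernel of `v ↦ R(L_{(u,x)}(v))`. -/
def linKer {n p m : ℕ} (f : Eu n → Eu p → Eu n) (R : Eu n →L[ℝ] Eu m)
    (u : Control p) (x : Eu n) : Set (Control p) :=
  {v | R (linEndpoint f u x v) = 0}

/-! ### Submanifolds, tangent spaces and transversality in a Banach space -/

section Banach

variable {X : Type*} [NormedAddCommGroup X] [NormedSpace ℝ X]

/-- `S` is a smooth Banach submanifold near `u`: some smooth local chart of `X` around `u`
straightens `S` to a closed complemented subspace. -/
def IsSubmanifoldAt (S : Set X) (u : X) : Prop :=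
  ∃ (T : Submodule ℝ X) (χ : OpenPartialHomeomorph X X),
    T.ClosedComplemented ∧ u ∈ χ.source ∧
    ContDiffOn ℝ ∞ χ χ.source ∧ ContDiffOn ℝ ∞ χ.symm χ.target ∧
    ∀ w ∈ χ.source, w ∈ S ↔ χ w ∈ T

/-- The tangent space at `u` of a subset `S` of a Banach space: the velocities at `u` of the
`C¹` curves in `S` through `u`. -/
def tangentAt (S : Set X) (u : X) : Set X :=
  {v | ∃ γ : ℝ → X, γ 0 = u ∧ ContDiffAt ℝ 1 γ 0 ∧ HasDerivAt γ v 0 ∧ ∀ᶠ t in 𝓝 (0 : ℝ), γ t ∈ S}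

/-- The members of a finite family `M` intersect transversally: at each common point, the tangent
space of each member and the intersection of the tangent spaces of all the others
together span the whole space. For two sets this is `T_u M₁ + T_u M₂ = X`. -/
def IntersectTransversally {q : ℕ} (M : Fin q → Set X) : Prop :=
  ∀ u ∈ ⋂ i, M i, ∀ i : Fin q, ∀ w : X,
    ∃ a ∈ tangentAt (M i) u, ∃ b ∈ ⋂ l ∈ {l : Fin q | l ≠ i}, tangentAt (M l) u, a + b = w

/-! ### Bracket-generating families -/

/-- Iterated Lie brackets of members of a family of vector fields. -/
inductive IsIteratedBracket (F : Set (X → X)) : (X → X) → Prop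
  | base (V : X → X) (hV : V ∈ F) : IsIteratedBracket F V
  | bracket (V W : X → X) (hV : IsIteratedBracket F V) (hW : IsIteratedBracket F W) :
      IsIteratedBracket F (VectorField.lieBracket ℝ V W)

/-- At each point of `s`, the Lie algebra generated by `F` evaluates to the full tangent space. -/
def IsBracketGeneratingOn (F : Set (X → X)) (s : Set X) : Prop :=
  ∀ a ∈ s, Submodule.span ℝ {v : X | ∃ W, IsIteratedBracket F W ∧ W a = v} = ⊤

end Banach

/-- The control vector fields `(f(·, c), …, f(·, c))`, `c ∈ ℝ^p`, of the `q`-folded system. -/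
def foldedFields {n p : ℕ} (f : Eu n → Eu p → Eu n) (q : ℕ) :
    Set ((Fin q → Eu n) → (Fin q → Eu n)) :=
  Set.range fun (c : Eu p) (a : Fin q → Eu n) (i : Fin q) => f (a i) c

/-- The `q`-folded system is bracket-generating on the `q`-tuples of distinct points. -/
def FoldedBracketGenerating {n p : ℕ} (f : Eu n → Eu p → Eu n) (q : ℕ) : Prop :=
  IsBracketGeneratingOn (foldedFields f q) {a : Fin q → Eu n | Function.Injective a}

/-- Strong memorization property of degree `q`: for all distinct points `x^1, …, x^q` and
all targets `y^1, …, y^q`, the sets `U(x^i, y^i)` have a common element and intersect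
transversally. -/
def StrongMemorization {n p m : ℕ} (f : Eu n → Eu p → Eu n) (R : Eu n →L[ℝ] Eu m)
    (q : ℕ) : Prop :=
  ∀ (x : Fin q → Eu n) (y : Fin q → Eu m), Function.Injective x →
    (⋂ i, controlSet f R (x i) (y i)).Nonempty ∧
      IntersectTransversally fun i => controlSet f R (x i) (y i)

end NeuralODE

end

/-!
A trajectory of the control system is a solution `ξ ∈ L^∞` of `ξ = x + V (f ∘ (ξ, u))`, where `V` is
the Volterra integration operator `w ↦ ∫₀ᵗ w`. The superposition map `(ξ, u) ↦ f ∘ (ξ, u)` is smooth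
on `L^∞`, and for every bounded operator-valued function `A` the operator `1 - V ∘ A` is invertible,
because the powers of `V ∘ A` decay like `‖A‖ᵏ / k!`. Hence the implicit function theorem applies,
and the end-point map `u ↦ φ(u, x)` is smooth. Differentiating the integral equation shows that the
derivative solves the linearized system with zero initial value, so by variation of constants it
is `L_{(u,x)}`.

Linearized controllability says that this derivative is onto. Transversality of all the sets
`U(x^i, ·)` allows one to correct a variation that moves the `i`-th end point in such a way that the
outputs at the other points stay fixed to first order, so that the joint output map of several
points is a submersion as well, onto a power of the range of `R`. The level sets of a submersion
with split kernel are straightened to that kernel by a local chart, which gives the submanifold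
structure together with the tangent space.
-/

namespace NeuralODE

section Nemytskii

universe w

variable {α : Type*} [MeasurableSpace α] {μ : Measure α}

section Norm

variable {E : Type*} [NormedAddCommGroup E]

theorem ae_norm_le_toReal_eLpNorm_top {h : α → E} (hh : MemLp h ∞ μ) :
    ∀ᵐ t ∂μ, ‖h t‖ ≤ (eLpNorm h ∞ μ).toReal := by
  filter_upwards [ae_le_eLpNormEssSup (f := h) (μ := μ)] with t ht
  rw [← toReal_enorm]
  exact ENNReal.toReal_mono hh.eLpNorm_ne_top (ht.trans_eq eLpNorm_exponent_top.symm)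

theorem ae_norm_le_Linfty_norm (u : Lp E ∞ μ) : ∀ᵐ t ∂μ, ‖u t‖ ≤ ‖u‖ :=
  ae_norm_le_toReal_eLpNorm_top (Lp.memLp u)

theorem Linfty_norm_le_of_ae_bound {u : Lp E ∞ μ} {C : ℝ} (hC : 0 ≤ C)
    (h : ∀ᵐ t ∂μ, ‖u t‖ ≤ C) : ‖u‖ ≤ C := by
  rw [Lp.norm_def, eLpNorm_exponent_top]
  exact ENNReal.toReal_le_of_le_ofReal hC (eLpNormEssSup_le_of_ae_bound h)

end Norm

theorem memLp_top_comp_of_continuous {E F : Type*} [NormedAddCommGroup E] [ProperSpace E]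
    [NormedAddCommGroup F] {g : E → F} (hg : Continuous g) {h : α → E} (hh : MemLp h ∞ μ) :
    MemLp (fun t => g (h t)) ∞ μ := by
  obtain ⟨C, hC⟩ := (isCompact_closedBall (0 : E)
    (eLpNorm h ∞ μ).toReal).exists_bound_of_continuousOn hg.continuousOn
  refine memLp_top_of_bound (hg.comp_aestronglyMeasurable hh.1) C ?_
  filter_upwards [ae_norm_le_toReal_eLpNorm_top hh] with t ht
  exact hC _ (mem_closedBall_zero_iff.2 ht)

/-- The superposition (Nemytskii) operator `u ↦ g ∘ u` on `L^∞`. -/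
noncomputable def nemytskii {E F : Type*} [NormedAddCommGroup E] [ProperSpace E]
    [NormedAddCommGroup F] (g : E → F) (hg : Continuous g) (u : Lp E ∞ μ) : Lp F ∞ μ :=
  (memLp_top_comp_of_continuous hg (Lp.memLp u)).toLp

theorem coeFn_nemytskii {E F : Type*} [NormedAddCommGroup E] [ProperSpace E]
    [NormedAddCommGroup F] {g : E → F} (hg : Continuous g) (u : Lp E ∞ μ) :
    nemytskii g hg u =ᵐ[μ] fun t => g (u t) :=
  MemLp.coeFn_toLp _

/-- Pointwise application of operator-valued `L^∞` functions to vector-valued ones. -/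
noncomputable def applyL (μ : Measure α) (E F : Type*) [NormedAddCommGroup E] [NormedSpace ℝ E]
    [NormedAddCommGroup F] [NormedSpace ℝ F] :
    Lp (E →L[ℝ] F) ∞ μ →L[ℝ] Lp E ∞ μ →L[ℝ] Lp F ∞ μ :=
  (ContinuousLinearMap.id ℝ (E →L[ℝ] F)).holderL μ ∞ ∞ ∞

theorem coeFn_applyL {E F : Type*} [NormedAddCommGroup E] [NormedSpace ℝ E]
    [NormedAddCommGroup F] [NormedSpace ℝ F] (A : Lp (E →L[ℝ] F) ∞ μ) (h : Lp E ∞ μ) :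
    applyL μ E F A h =ᵐ[μ] fun t => A t (h t) :=
  ContinuousLinearMap.coeFn_holder (ContinuousLinearMap.id ℝ (E →L[ℝ] F)) A h

theorem exists_norm_taylor_remainder_le_of_norm_le {E F : Type*} [NormedAddCommGroup E]
    [NormedSpace ℝ E] [ProperSpace E] [NormedAddCommGroup F] [NormedSpace ℝ F] {g : E → F}
    (hg : ContDiff ℝ 1 g) (r : ℝ) {ε : ℝ} (hε : 0 < ε) :
    ∃ δ > 0, ∀ a h : E, ‖a‖ ≤ r → ‖h‖ < δ → ‖g (a + h) - g a - fderiv ℝ g a h‖ ≤ ε * ‖h‖ := by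
  obtain ⟨δ, hδ, hunif⟩ := Metric.uniformContinuousOn_iff.1
    ((isCompact_closedBall (0 : E) (r + 1)).uniformContinuousOn_of_continuous
      (hg.continuous_fderiv one_ne_zero).continuousOn) ε hε
  refine ⟨min δ 1, lt_min hδ one_pos, fun a h ha hh => ?_⟩
  obtain ⟨hhδ, hh1⟩ := lt_min_iff.1 hh
  have hderiv : ∀ z ∈ Metric.closedBall a ‖h‖, ‖fderiv ℝ g z - fderiv ℝ g a‖ ≤ ε := by
    intro z hz
    rw [mem_closedBall_iff_norm] at hz
    have hz' : ‖z‖ ≤ ‖a‖ + ‖z - a‖ := norm_le_norm_add_norm_sub' z a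
    rw [← dist_eq_norm]
    refine (hunif z ?_ a ?_ (dist_eq_norm z a ▸ hz.trans_lt hhδ)).le <;>
      rw [mem_closedBall_zero_iff] <;> linarith
  simpa only [add_sub_cancel_left] using
    (convex_closedBall a ‖h‖).norm_image_sub_le_of_norm_hasFDerivWithin_le' (x := a) (y := a + h)
      (fun z _ => ((hg.differentiable one_ne_zero) z).hasFDerivAt.hasFDerivWithinAt) hderiv
      (by simp) (by simp)

variable {E : Type*} [NormedAddCommGroup E] [NormedSpace ℝ E] [ProperSpace E]

theorem hasFDerivAt_nemytskii {F : Type*} [NormedAddCommGroup F] [NormedSpace ℝ F]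
    {g : E → F} (hg : ContDiff ℝ 1 g) (u : Lp E ∞ μ) :
    HasFDerivAt (nemytskii (μ := μ) g hg.continuous)
      (applyL μ E F (nemytskii (fderiv ℝ g) (hg.continuous_fderiv one_ne_zero) u)) u := by
  rw [hasFDerivAt_iff_isLittleO_nhds_zero, Asymptotics.isLittleO_iff]
  intro ε hε
  obtain ⟨δ, hδ, hrem⟩ := exists_norm_taylor_remainder_le_of_norm_le hg ‖u‖ hε
  filter_upwards [Metric.ball_mem_nhds (0 : Lp E ∞ μ) hδ] with h hh
  rw [mem_ball_zero_iff] at hh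
  set A : Lp (E →L[ℝ] F) ∞ μ := nemytskii (fderiv ℝ g) (hg.continuous_fderiv one_ne_zero) u
  refine Linfty_norm_le_of_ae_bound (by positivity) ?_
  filter_upwards [ae_norm_le_Linfty_norm u, ae_norm_le_Linfty_norm h, Lp.coeFn_add u h,
    coeFn_nemytskii hg.continuous (u + h), coeFn_nemytskii hg.continuous u,
    coeFn_nemytskii (hg.continuous_fderiv one_ne_zero) u, coeFn_applyL A h,
    Lp.coeFn_sub (nemytskii g hg.continuous (u + h) - nemytskii g hg.continuous u)
      (applyL μ E F A h),
    Lp.coeFn_sub (nemytskii g hg.continuous (u + h)) (nemytskii g hg.continuous u)]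
    with t hut hht hadd hguh hgu hg'u happ hsub hsub'
  rw [hsub, Pi.sub_apply, hsub', Pi.sub_apply, hguh, hgu, happ, hg'u, hadd, Pi.add_apply]
  exact (hrem (u t) (h t) hut (hht.trans_lt hh)).trans (by gcongr)

-- The induction replaces `F` by `E →L[ℝ] F`, hence the common universe.
theorem contDiff_nemytskii {E F : Type w} [NormedAddCommGroup E] [NormedSpace ℝ E]
    [ProperSpace E] [NormedAddCommGroup F] [NormedSpace ℝ F]
    {g : E → F} (hg : ContDiff ℝ ∞ g) :
    ContDiff ℝ ∞ (nemytskii (μ := μ) g hg.continuous) := by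
  rw [contDiff_infty]
  intro k
  induction k generalizing F with
  | zero =>
    rw [Nat.cast_zero, contDiff_zero, continuous_iff_continuousAt]
    exact fun u => (hasFDerivAt_nemytskii (hg.of_le (by simp)) u).continuousAt
  | succ k ih =>
    have hg' : ContDiff ℝ ∞ (fderiv ℝ g) := (contDiff_infty_iff_fderiv.1 hg).2
    rw [Nat.cast_succ, contDiff_succ_iff_hasFDerivAt]
    exact ⟨fun u => applyL μ E F (nemytskii (fderiv ℝ g) hg'.continuous u),
      (applyL μ E F).contDiff.comp (ih hg'),
      fun u => hasFDerivAt_nemytskii (hg.of_le (by simp)) u⟩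

end Nemytskii

section Primitive

/-- Lebesgue measure on the unit interval. -/
noncomputable abbrev unitMeasure : Measure ℝ := volume.restrict (Icc (0 : ℝ) 1)

theorem ae_unitMeasure_iff {p : ℝ → Prop} :
    (∀ᵐ t ∂unitMeasure, p t) ↔ ∀ᵐ t, t ∈ Icc (0 : ℝ) 1 → p t :=
  ae_restrict_iff' measurableSet_Icc

theorem memLp_top_unitMeasure_of_continuousOn {F : Type*} [NormedAddCommGroup F] {z : ℝ → F}
    (hz : ContinuousOn z (Icc 0 1)) : MemLp z ∞ unitMeasure := by
  obtain ⟨C, hC⟩ := isCompact_Icc.exists_bound_of_continuousOn hz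
  exact memLp_top_of_bound (hz.aestronglyMeasurable_of_isCompact isCompact_Icc measurableSet_Icc) C
    (ae_restrict_of_forall_mem measurableSet_Icc hC)

theorem memLp_top_prodMk {E F : Type*} [NormedAddCommGroup E] [NormedAddCommGroup F]
    {z : ℝ → E} (hz : ContinuousOn z (Icc 0 1)) (w : Lp F ∞ unitMeasure) :
    MemLp (fun t => (z t, w t)) ∞ unitMeasure :=
  MemLp.of_fst_snd ⟨memLp_top_unitMeasure_of_continuousOn hz, Lp.memLp w⟩

theorem intervalIntegrable_of_memLp_top {F : Type*} [NormedAddCommGroup F] {g : ℝ → F}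
    (hg : MemLp g ∞ unitMeasure) {a b : ℝ} (ha : a ∈ Icc (0 : ℝ) 1) (hb : b ∈ Icc (0 : ℝ) 1) :
    IntervalIntegrable g volume a b :=
  ((show IntegrableOn g (Icc 0 1) volume from hg.integrable le_top).mono_set
    (uIcc_subset_Icc ha hb)).intervalIntegrable

variable {E F G : Type*} [NormedAddCommGroup E] [NormedSpace ℝ E]
  [NormedAddCommGroup F] [NormedSpace ℝ F] [NormedAddCommGroup G] [NormedSpace ℝ G]

theorem intervalIntegral_congr_ae_unitMeasure {g h : ℝ → F} (hgh : g =ᵐ[unitMeasure] h) {a b : ℝ}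
    (ha : a ∈ Icc (0 : ℝ) 1) (hb : b ∈ Icc (0 : ℝ) 1) : ∫ s in a..b, g s = ∫ s in a..b, h s :=
  intervalIntegral.integral_congr_ae <| (ae_unitMeasure_iff.1 hgh).mono fun _ hs hmem =>
    hs (uIcc_subset_Icc ha hb (uIoc_subset_uIcc hmem))

theorem norm_intervalIntegral_le_of_ae_bound {g : ℝ → F} {C : ℝ}
    (hg : ∀ᵐ t ∂unitMeasure, ‖g t‖ ≤ C) {a b : ℝ} (ha : a ∈ Icc (0 : ℝ) 1)
    (hb : b ∈ Icc (0 : ℝ) 1) : ‖∫ s in a..b, g s‖ ≤ C * |b - a| :=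
  intervalIntegral.norm_integral_le_of_norm_le_const_ae <|
    (ae_unitMeasure_iff.1 hg).mono fun _ hs hmem =>
      hs (uIcc_subset_Icc ha hb (uIoc_subset_uIcc hmem))

/-- On `[0,1]`, the function `z` is a primitive of the bounded function `z'`; that is, `z` belongs
to the Sobolev space `W^{1,∞}` and has weak derivative `z'`. -/
structure IsPrimitive (z z' : ℝ → F) : Prop where
  memLp_deriv : MemLp z' ∞ unitMeasure
  eq_add_integral : ∀ t ∈ Icc (0 : ℝ) 1, z t = z 0 + ∫ s in (0 : ℝ)..t, z' s

theorem isPrimitive_integral {z' : ℝ → F} (hz' : MemLp z' ∞ unitMeasure) :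
    IsPrimitive (fun t => ∫ s in (0 : ℝ)..t, z' s) z' :=
  ⟨hz', by simp⟩

namespace IsPrimitive

variable {z z' z'' : ℝ → F}

theorem congr_deriv_ae (hz : IsPrimitive z z') (h : z' =ᵐ[unitMeasure] z'') : IsPrimitive z z'' :=
  ⟨hz.memLp_deriv.ae_eq h, fun t ht => by
    rw [hz.eq_add_integral t ht, intervalIntegral_congr_ae_unitMeasure h (by simp) ht]⟩

theorem sub_eq_integral (hz : IsPrimitive z z') {s t : ℝ} (hs : s ∈ Icc (0 : ℝ) 1)
    (ht : t ∈ Icc (0 : ℝ) 1) : z t - z s = ∫ r in s..t, z' r := by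
  have h0 : (0 : ℝ) ∈ Icc (0 : ℝ) 1 := by simp
  rw [hz.eq_add_integral t ht, hz.eq_add_integral s hs, add_sub_add_left_eq_sub]
  exact intervalIntegral.integral_interval_sub_left
    (intervalIntegrable_of_memLp_top hz.memLp_deriv h0 ht)
    (intervalIntegrable_of_memLp_top hz.memLp_deriv h0 hs)

theorem exists_lipschitzOnWith (hz : IsPrimitive z z') : ∃ K, LipschitzOnWith K z (Icc 0 1) := by
  refine ⟨(eLpNorm z' ∞ unitMeasure).toNNReal, LipschitzOnWith.of_dist_le_mul fun t ht s hs => ?_⟩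
  rw [dist_eq_norm, hz.sub_eq_integral hs ht, Real.dist_eq]
  exact norm_intervalIntegral_le_of_ae_bound (ae_norm_le_toReal_eLpNorm_top hz.memLp_deriv) hs ht

theorem continuousOn (hz : IsPrimitive z z') : ContinuousOn z (Icc 0 1) :=
  hz.exists_lipschitzOnWith.choose_spec.continuousOn

theorem memLp (hz : IsPrimitive z z') : MemLp z ∞ unitMeasure :=
  memLp_top_unitMeasure_of_continuousOn hz.continuousOn

theorem ae_hasDerivAt [CompleteSpace F] (hz : IsPrimitive z z') :
    ∀ᵐ t ∂unitMeasure, HasDerivAt z (z' t) t := by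
  have hint := (intervalIntegrable_of_memLp_top hz.memLp_deriv (a := 0) (b := 1)
    (by simp) (by simp)).ae_hasDerivAt_integral
  rw [uIcc_of_le zero_le_one] at hint
  rw [unitMeasure, ← Measure.restrict_congr_set Ioo_ae_eq_Icc, ae_restrict_iff' measurableSet_Ioo]
  filter_upwards [hint] with t ht hmem
  refine ((ht (Ioo_subset_Icc_self hmem) 0 (by simp)).const_add (z 0)).congr_of_eventuallyEq ?_
  filter_upwards [Icc_mem_nhds hmem.1 hmem.2] with s hs using hz.eq_add_integral s hs

end IsPrimitive

theorem isPrimitive_of_lipschitzOnWith [CompleteSpace F] {z z' : ℝ → F} {K : NNReal}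
    (hz : LipschitzOnWith K z (Icc 0 1)) (hz' : MemLp z' ∞ unitMeasure)
    (hderiv : ∀ᵐ t ∂unitMeasure, HasDerivAt z (z' t) t) : IsPrimitive z z' := by
  have hprim := isPrimitive_integral hz'
  obtain ⟨K', hK'⟩ := hprim.exists_lipschitzOnWith
  have hac : AbsolutelyContinuousOnInterval
      (z - fun t => ∫ s in (0 : ℝ)..t, z' s) 0 1 := by
    rw [← uIcc_of_le zero_le_one] at hz hK'
    exact hz.absolutelyContinuousOnInterval.sub hK'.absolutelyContinuousOnInterval
  have hzero : ∀ᵐ t, t ∈ uIcc (0 : ℝ) 1 →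
      HasDerivAt (z - fun t => ∫ s in (0 : ℝ)..t, z' s) 0 t := by
    rw [uIcc_of_le zero_le_one, ← ae_unitMeasure_iff]
    filter_upwards [hderiv, hprim.ae_hasDerivAt] with t h1 h2
    simpa only [sub_self] using h1.sub h2
  obtain ⟨C, hC⟩ := hac.const_of_ae_hasDerivAt_zero hzero
  rw [uIcc_of_le zero_le_one] at hC
  refine ⟨hz', fun t ht => sub_eq_iff_eq_add.1 ?_⟩
  simpa using (hC t ht).trans (hC 0 (by simp)).symm

namespace IsPrimitive

variable {z z' : ℝ → F}

theorem eq_of_deriv_ae_eq_zero (hz : IsPrimitive z z') (hz' : z' =ᵐ[unitMeasure] 0) {s t : ℝ}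
    (hs : s ∈ Icc (0 : ℝ) 1) (ht : t ∈ Icc (0 : ℝ) 1) : z t = z s := by
  rw [← sub_eq_zero, hz.sub_eq_integral hs ht, intervalIntegral_congr_ae_unitMeasure hz' hs ht]
  exact intervalIntegral.integral_zero

theorem clm_comp [CompleteSpace F] [CompleteSpace G] (hz : IsPrimitive z z') (L : F →L[ℝ] G) :
    IsPrimitive (fun t => L (z t)) (fun t => L (z' t)) := by
  refine ⟨L.comp_memLp' hz.memLp_deriv, fun t ht => ?_⟩
  rw [L.intervalIntegral_comp_comm
    (intervalIntegrable_of_memLp_top hz.memLp_deriv (by simp) ht), ← map_add,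
    ← hz.eq_add_integral t ht]

theorem bilin [CompleteSpace E] [CompleteSpace F] [CompleteSpace G] (B : E →L[ℝ] F →L[ℝ] G)
    {y y' : ℝ → E} (hy : IsPrimitive y y') (hz : IsPrimitive z z') :
    IsPrimitive (fun t => B (y t) (z t)) (fun t => B (y t) (z' t) + B (y' t) (z t)) := by
  obtain ⟨K, hK⟩ := hy.exists_lipschitzOnWith
  obtain ⟨K', hK'⟩ := hz.exists_lipschitzOnWith
  have hB : ContDiff ℝ 1 fun p : E × F => B p.1 p.2 := by fun_prop
  obtain ⟨C, hC⟩ := (hB.locallyLipschitz.locallyLipschitzOn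
    (s := (fun t => (y t, z t)) '' Icc (0 : ℝ) 1)).exists_lipschitzOnWith_of_compact
      (isCompact_Icc.image_of_continuousOn (hy.continuousOn.prodMk hz.continuousOn))
  refine isPrimitive_of_lipschitzOnWith (hC.comp (hK.prodMk hK') (mapsTo_image _ _))
    ((B.memLp_of_bilin ∞ hy.memLp hz.memLp_deriv).add
      (B.memLp_of_bilin ∞ hy.memLp_deriv hz.memLp)) ?_
  filter_upwards [hy.ae_hasDerivAt, hz.ae_hasDerivAt] with t hyt hzt
  exact ((B.hasFDerivAt.comp_hasDerivAt t hyt).clm_apply hzt).congr_deriv (add_comm _ _)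

end IsPrimitive

end Primitive

section Volterra

variable {F : Type*} [NormedAddCommGroup F] [NormedSpace ℝ F]

/-- The Volterra integration operator `w ↦ (t ↦ ∫₀ᵗ w)` on `L^∞([0,1], F)`. -/
noncomputable def volterra (F : Type*) [NormedAddCommGroup F] [NormedSpace ℝ F] :
    Lp F ∞ unitMeasure →L[ℝ] Lp F ∞ unitMeasure :=
  LinearMap.mkContinuous
    { toFun := fun w => (isPrimitive_integral (Lp.memLp w)).memLp.toLp
      map_add' := fun v w => by
        rw [← MemLp.toLp_add]
        refine MemLp.toLp_congr _ _ (ae_restrict_of_forall_mem measurableSet_Icc fun t ht => ?_)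
        simp only [Pi.add_apply]
        rw [intervalIntegral_congr_ae_unitMeasure (Lp.coeFn_add v w) (by simp) ht]
        exact intervalIntegral.integral_add
          (intervalIntegrable_of_memLp_top (Lp.memLp v) (by simp) ht)
          (intervalIntegrable_of_memLp_top (Lp.memLp w) (by simp) ht)
      map_smul' := fun c w => by
        rw [RingHom.id_apply, ← MemLp.toLp_const_smul]
        refine MemLp.toLp_congr _ _ (ae_restrict_of_forall_mem measurableSet_Icc fun t ht => ?_)
        simp only [Pi.smul_apply]
        rw [intervalIntegral_congr_ae_unitMeasure (Lp.coeFn_smul c w) (by simp) ht]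
        exact intervalIntegral.integral_smul c _ }
    1 fun w => by
      refine Linfty_norm_le_of_ae_bound (by positivity) ?_
      filter_upwards [(isPrimitive_integral (Lp.memLp w)).memLp.coeFn_toLp,
        ae_restrict_mem measurableSet_Icc] with t ht hmem
      rw [LinearMap.coe_mk, AddHom.coe_mk, ht, one_mul]
      refine (norm_intervalIntegral_le_of_ae_bound (ae_norm_le_Linfty_norm w) (by simp) hmem).trans
        (mul_le_of_le_one_right (norm_nonneg w) ?_)
      rw [sub_zero, abs_of_nonneg hmem.1]
      exact hmem.2

theorem coeFn_volterra (w : Lp F ∞ unitMeasure) :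
    volterra F w =ᵐ[unitMeasure] fun t => ∫ s in (0 : ℝ)..t, w s :=
  (isPrimitive_integral (Lp.memLp w)).memLp.coeFn_toLp

/-- The Volterra operator `w ↦ (t ↦ ∫₀ᵗ A w)` whose kernel is the operator-valued function `A`. -/
noncomputable def volterraMul (A : Lp (F →L[ℝ] F) ∞ unitMeasure) :
    Lp F ∞ unitMeasure →L[ℝ] Lp F ∞ unitMeasure :=
  volterra F ∘L applyL unitMeasure F F A

theorem coeFn_volterraMul (A : Lp (F →L[ℝ] F) ∞ unitMeasure) (w : Lp F ∞ unitMeasure) :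
    volterraMul A w =ᵐ[unitMeasure] fun t => ∫ s in (0 : ℝ)..t, A s (w s) := by
  filter_upwards [coeFn_volterra (applyL unitMeasure F F A w), ae_restrict_mem measurableSet_Icc]
    with t ht hmem
  exact ht.trans (intervalIntegral_congr_ae_unitMeasure (coeFn_applyL A w) (by simp) hmem)

theorem norm_integral_le_of_norm_le_mul_pow {g : ℝ → F} {C : ℝ} {k : ℕ}
    (hg : ∀ᵐ s ∂unitMeasure, ‖g s‖ ≤ C * s ^ k) {t : ℝ} (ht : t ∈ Icc (0 : ℝ) 1) :
    ‖∫ s in (0 : ℝ)..t, g s‖ ≤ C / (k + 1) * t ^ (k + 1) := by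
  calc ‖∫ s in (0 : ℝ)..t, g s‖ ≤ ∫ s in (0 : ℝ)..t, C * s ^ k := by
        refine intervalIntegral.norm_integral_le_of_norm_le ht.1 ?_
          (Continuous.intervalIntegrable (by fun_prop) 0 t)
        filter_upwards [ae_unitMeasure_iff.1 hg] with s hs hmem
        exact hs ⟨hmem.1.le, hmem.2.trans ht.2⟩
    _ = C / (k + 1) * t ^ (k + 1) := by
        rw [intervalIntegral.integral_const_mul, integral_pow, zero_pow k.succ_ne_zero]
        ring

theorem ae_norm_volterraMul_pow_apply_le (A : Lp (F →L[ℝ] F) ∞ unitMeasure)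
    (w : Lp F ∞ unitMeasure) (k : ℕ) : ∀ᵐ t ∂unitMeasure,
      ‖(volterraMul A ^ k) w t‖ ≤ ‖A‖ ^ k / k.factorial * ‖w‖ * t ^ k := by
  induction k with
  | zero => simpa using ae_norm_le_Linfty_norm w
  | succ k ih =>
    set z := (volterraMul A ^ k) w
    have hAz : ∀ᵐ s ∂unitMeasure,
        ‖A s (z s)‖ ≤ ‖A‖ * (‖A‖ ^ k / k.factorial * ‖w‖) * s ^ k := by
      filter_upwards [ih, ae_norm_le_Linfty_norm A] with s hzs hAs
      calc ‖A s (z s)‖ ≤ ‖A s‖ * ‖z s‖ := (A s).le_opNorm _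
        _ ≤ ‖A‖ * (‖A‖ ^ k / k.factorial * ‖w‖ * s ^ k) := by gcongr
        _ = ‖A‖ * (‖A‖ ^ k / k.factorial * ‖w‖) * s ^ k := by ring
    rw [show (volterraMul A ^ (k + 1)) w = volterraMul A z by rw [pow_succ']; rfl]
    filter_upwards [coeFn_volterraMul A z, ae_restrict_mem measurableSet_Icc] with t ht hmem
    rw [ht]
    refine (norm_integral_le_of_norm_le_mul_pow hAz hmem).trans_eq ?_
    rw [Nat.factorial_succ]
    push_cast
    field_simp
    ring

theorem norm_volterraMul_pow_le (A : Lp (F →L[ℝ] F) ∞ unitMeasure) (k : ℕ) :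
    ‖volterraMul A ^ k‖ ≤ ‖A‖ ^ k / k.factorial := by
  refine ContinuousLinearMap.opNorm_le_bound _ (by positivity) fun w => ?_
  refine Linfty_norm_le_of_ae_bound (by positivity) ?_
  filter_upwards [ae_norm_volterraMul_pow_apply_le A w k, ae_restrict_mem measurableSet_Icc]
    with t ht hmem
  exact ht.trans (mul_le_of_le_one_right (by positivity) (pow_le_one₀ hmem.1 hmem.2))

theorem isUnit_one_sub_of_norm_pow_lt_one {R : Type*} [NormedRing R] [CompleteSpace R] {a : R}
    {k : ℕ} (hk : ‖a ^ k‖ < 1) : IsUnit (1 - a) := by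
  have hunit : IsUnit (1 - a ^ k) := isUnit_one_sub_of_norm_lt_one hk
  have hcomm : Commute (1 - a) (∑ i ∈ Finset.range k, a ^ i) :=
    Commute.sum_right _ _ _ fun i _ => ((Commute.one_left a).sub_left (Commute.refl a)).pow_right i
  rw [← mul_neg_geom_sum] at hunit
  exact (hcomm.isUnit_mul_iff.1 hunit).1

theorem isUnit_one_sub_volterraMul [CompleteSpace F] (A : Lp (F →L[ℝ] F) ∞ unitMeasure) :
    IsUnit (1 - volterraMul A) := by
  obtain ⟨k, hk⟩ :=
    ((FloorSemiring.tendsto_pow_div_factorial_atTop ‖A‖).eventually_lt_const one_pos).exists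
  exact isUnit_one_sub_of_norm_pow_lt_one ((norm_volterraMul_pow_le A k).trans_lt hk)

end Volterra

section LinearODE

theorem exists_isPrimitive_linear {W : Type*} [NormedAddCommGroup W] [NormedSpace ℝ W]
    [CompleteSpace W] {A : ℝ → W →L[ℝ] W} (hA : MemLp A ∞ unitMeasure) (c : W) :
    ∃ z, z 0 = c ∧ IsPrimitive z (fun t => A t (z t)) := by
  obtain ⟨w, hw⟩ := (ContinuousLinearMap.isUnit_iff_bijective.1
    (isUnit_one_sub_volterraMul hA.toLp)).2 (Lp.const ∞ unitMeasure c)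
  set A' := hA.toLp
  have hwA : ∀ᵐ t ∂unitMeasure, w t = c + ∫ s in (0 : ℝ)..t, A' s (w s) := by
    replace hw : w - volterraMul A' w = Lp.const ∞ unitMeasure c := hw
    rw [sub_eq_iff_eq_add] at hw
    filter_upwards [Lp.coeFn_add (Lp.const ∞ unitMeasure c) (volterraMul A' w),
      Lp.coeFn_const (p := ∞) (μ := unitMeasure) c, coeFn_volterraMul A' w] with t hadd hc hV
    calc w t = (Lp.const ∞ unitMeasure c + volterraMul A' w : Lp W ∞ unitMeasure) t := by rw [← hw]
      _ = c + ∫ s in (0 : ℝ)..t, A' s (w s) := by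
        rw [hadd, Pi.add_apply, hc, hV, Function.const_apply]
  have hAw := (Lp.memLp _).ae_eq (coeFn_applyL A' w)
  have hz : IsPrimitive (fun t => c + ∫ s in (0 : ℝ)..t, A' s (w s)) _ := ⟨hAw, by simp⟩
  refine ⟨_, by simp, hz.congr_deriv_ae ?_⟩
  filter_upwards [hwA, hA.coeFn_toLp] with t ht hAt
  rw [← ht, hAt]

variable {X : Type*} [NormedAddCommGroup X] [NormedSpace ℝ X] {A Φ Θ : ℝ → X →L[ℝ] X}

/-- A fundamental solution `Φ` of the linear system `ż = A z` on `[0,1]`, together with its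
pointwise inverse `Θ`, which solves the adjoint equation `Θ̇ = -Θ A`. -/
structure IsFundamentalPair (A Φ Θ : ℝ → X →L[ℝ] X) : Prop where
  isPrimitive_left : IsPrimitive Φ (fun t => A t ∘L Φ t)
  isPrimitive_right : IsPrimitive Θ (fun t => -(Θ t ∘L A t))
  comp_eq_id : ∀ t ∈ Icc (0 : ℝ) 1, Φ t ∘L Θ t = ContinuousLinearMap.id ℝ X

theorem exists_isFundamentalPair [FiniteDimensional ℝ X] (hA : MemLp A ∞ unitMeasure) :
    ∃ Φ Θ, IsFundamentalPair A Φ Θ := by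
  have := FiniteDimensional.complete ℝ X
  obtain ⟨Φ, hΦ0, hΦ⟩ := exists_isPrimitive_linear
    ((ContinuousLinearMap.compL ℝ X X X).comp_memLp' hA) (ContinuousLinearMap.id ℝ X)
  obtain ⟨Θ, hΘ0, hΘ⟩ := exists_isPrimitive_linear
    ((-(ContinuousLinearMap.compL ℝ X X X).flip).comp_memLp' hA) (ContinuousLinearMap.id ℝ X)
  refine ⟨Φ, Θ, hΦ, hΘ, fun t ht => ?_⟩
  have hΘΦ : Θ t ∘L Φ t = Θ 0 ∘L Φ 0 :=
    (hΘ.bilin (ContinuousLinearMap.compL ℝ X X X) hΦ).eq_of_deriv_ae_eq_zero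
      (Eventually.of_forall fun s => by ext; simp) (by simp) ht
  rw [hΦ0, hΘ0, ContinuousLinearMap.id_comp] at hΘΦ
  ext1 v
  have hΘΦ' : (Θ t : X →ₗ[ℝ] X) * (Φ t : X →ₗ[ℝ] X) = 1 :=
    congrArg ContinuousLinearMap.toLinearMap hΘΦ
  exact LinearMap.congr_fun (mul_eq_one_comm.1 hΘΦ') v

namespace IsFundamentalPair

variable [CompleteSpace X]

theorem eq_comp_of_isPrimitive (h : IsFundamentalPair A Φ Θ) {Ψ : ℝ → X →L[ℝ] X}
    (hΨ : IsPrimitive Ψ (fun t => A t ∘L Ψ t)) {t τ : ℝ} (ht : t ∈ Icc (0 : ℝ) 1)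
    (hτ : τ ∈ Icc (0 : ℝ) 1) : Ψ t = Φ t ∘L Θ τ ∘L Ψ τ := by
  have hΘΨ : Θ t ∘L Ψ t = Θ τ ∘L Ψ τ :=
    (h.isPrimitive_right.bilin (ContinuousLinearMap.compL ℝ X X X) hΨ).eq_of_deriv_ae_eq_zero
      (Eventually.of_forall fun s => by ext; simp) hτ ht
  rw [← hΘΨ, ← ContinuousLinearMap.comp_assoc, h.comp_eq_id t ht, ContinuousLinearMap.id_comp]

theorem variation_of_constants (h : IsFundamentalPair A Φ Θ) {z b : ℝ → X}
    (hz : IsPrimitive z (fun t => A t (z t) + b t)) {t : ℝ} (ht : t ∈ Icc (0 : ℝ) 1) :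
    z t = Φ t (Θ 0 (z 0)) + ∫ τ in (0 : ℝ)..t, (Φ t ∘L Θ τ) (b τ) := by
  have hΘz : IsPrimitive (fun t => Θ t (z t)) (fun t => Θ t (b t)) :=
    (h.isPrimitive_right.bilin (ContinuousLinearMap.id ℝ (X →L[ℝ] X)) hz).congr_deriv_ae
      (Eventually.of_forall fun s => by simp)
  calc z t = (Φ t ∘L Θ t) (z t) := by rw [h.comp_eq_id t ht]; rfl
    _ = Φ t (Θ 0 (z 0) + ∫ τ in (0 : ℝ)..t, Θ τ (b τ)) := by
        rw [← hΘz.eq_add_integral t ht]; rfl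
    _ = Φ t (Θ 0 (z 0)) + ∫ τ in (0 : ℝ)..t, (Φ t ∘L Θ τ) (b τ) := by
        rw [map_add, ← (Φ t).intervalIntegral_comp_comm
          (intervalIntegrable_of_memLp_top hΘz.memLp_deriv (by simp) ht)]
        rfl

end IsFundamentalPair

end LinearODE

section Implicit

variable {V Y : Type*} [NormedAddCommGroup V] [NormedSpace ℝ V] [CompleteSpace V]
  [NormedAddCommGroup Y] [NormedSpace ℝ Y] [CompleteSpace Y]

theorem contDiff_of_implicit {G : V × Y → Y} (hG : ContDiff ℝ ∞ G) {S : V → Y}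
    (hS : ∀ u, G (u, S u) = 0) (huniq : ∀ u y, G (u, y) = 0 → y = S u)
    (hinv : ∀ u, ∃ L : V × Y →L[ℝ] Y, HasFDerivAt G L (u, S u) ∧
      (L ∘L .inr ℝ V Y).IsInvertible) : ContDiff ℝ ∞ S := by
  rw [contDiff_iff_contDiffAt]
  intro u
  obtain ⟨L, hL, hLinv⟩ := hinv u
  rw [← hL.fderiv] at hLinv
  have hGu : ContDiffAt ℝ ∞ G (u, S u) := hG.contDiffAt
  refine (hGu.contDiffAt_implicitFunction (by simp) hLinv).congr_of_eventuallyEq ?_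
  filter_upwards [hGu.eventually_apply_implicitFunction (by simp) hLinv] with v hv
  exact (huniq _ _ (hv.trans (hS u))).symm

end Implicit

section SolutionMap

universe w

/-- The integral over `[0,1]` as a continuous linear functional on `L^∞`. -/
noncomputable def integralL (F : Type*) [NormedAddCommGroup F] [NormedSpace ℝ F]
    [CompleteSpace F] : Lp F ∞ unitMeasure →L[ℝ] F :=
  (ContinuousLinearMap.lsmul ℝ ℝ).lpPairing unitMeasure 1 ∞ (Lp.const 1 unitMeasure (1 : ℝ))

theorem integralL_apply {F : Type*} [NormedAddCommGroup F] [NormedSpace ℝ F] [CompleteSpace F]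
    (w : Lp F ∞ unitMeasure) : integralL F w = ∫ t in (0 : ℝ)..1, w t := by
  rw [integralL, ContinuousLinearMap.lpPairing_eq_integral,
    intervalIntegral.integral_of_le zero_le_one, ← integral_Icc_eq_integral_Ioc]
  refine integral_congr_ae ?_
  filter_upwards [Lp.coeFn_const (p := 1) (μ := unitMeasure) (1 : ℝ)] with t ht
  rw [ht]
  exact one_smul ℝ (w t)

/-- The pairing `(ξ, u) ↦ (t ↦ (ξ t, u t))` of two `L^∞` functions. -/
noncomputable def pairL (X P : Type*) [NormedAddCommGroup X] [NormedSpace ℝ X]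
    [NormedAddCommGroup P] [NormedSpace ℝ P] :
    Lp X ∞ unitMeasure × Lp P ∞ unitMeasure →L[ℝ] Lp (X × P) ∞ unitMeasure :=
  ((ContinuousLinearMap.inl ℝ X P).compLpL ∞ unitMeasure).coprod
    ((ContinuousLinearMap.inr ℝ X P).compLpL ∞ unitMeasure)

variable {X P : Type w} [NormedAddCommGroup X] [NormedSpace ℝ X]
  [NormedAddCommGroup P] [NormedSpace ℝ P]

theorem coeFn_pairL (ξ : Lp X ∞ unitMeasure) (u : Lp P ∞ unitMeasure) :
    pairL X P (ξ, u) =ᵐ[unitMeasure] fun t => (ξ t, u t) := by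
  rw [pairL, ContinuousLinearMap.coprod_apply]
  filter_upwards [Lp.coeFn_add ((ContinuousLinearMap.inl ℝ X P).compLpL ∞ unitMeasure ξ)
    ((ContinuousLinearMap.inr ℝ X P).compLpL ∞ unitMeasure u),
    (ContinuousLinearMap.inl ℝ X P).coeFn_compLpL (p := ∞) ξ,
    (ContinuousLinearMap.inr ℝ X P).coeFn_compLpL (p := ∞) u] with t hadd hξ hu
  rw [hadd, Pi.add_apply, hξ, hu]
  simp

variable [ProperSpace X] [ProperSpace P] {F : X × P → X} (hF : ContDiff ℝ ∞ F)

/-- The velocity `t ↦ F (ξ t, u t)` along a pair of `L^∞` functions `z = (ξ, u)`. -/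
noncomputable def velocity {F : X × P → X} (hF : ContDiff ℝ ∞ F)
    (z : Lp X ∞ unitMeasure × Lp P ∞ unitMeasure) : Lp X ∞ unitMeasure :=
  nemytskii F hF.continuous (pairL X P z)

/-- The derivative `t ↦ DF (ξ t, u t)` along a pair of `L^∞` functions `z = (ξ, u)`. -/
noncomputable def derivAlong {F : X × P → X} (hF : ContDiff ℝ ∞ F)
    (z : Lp X ∞ unitMeasure × Lp P ∞ unitMeasure) : Lp (X × P →L[ℝ] X) ∞ unitMeasure :=
  nemytskii (fderiv ℝ F) (hF.continuous_fderiv (by simp)) (pairL X P z)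

/-- The partial derivative `t ↦ ∂F/∂x (ξ t, u t)` along a pair of `L^∞` functions `z = (ξ, u)`. -/
noncomputable def derivFstAlong {F : X × P → X} (hF : ContDiff ℝ ∞ F)
    (z : Lp X ∞ unitMeasure × Lp P ∞ unitMeasure) : Lp (X →L[ℝ] X) ∞ unitMeasure :=
  nemytskii (fun p => fderiv ℝ F p ∘L .inl ℝ X P)
    ((hF.continuous_fderiv (by simp)).clm_comp continuous_const) (pairL X P z)

theorem coeFn_velocity (ξ : Lp X ∞ unitMeasure) (u : Lp P ∞ unitMeasure) :
    velocity hF (ξ, u) =ᵐ[unitMeasure] fun t => F (ξ t, u t) := by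
  filter_upwards [coeFn_nemytskii hF.continuous (pairL X P (ξ, u)), coeFn_pairL ξ u]
    with t hnem hpair
  rw [velocity, hnem, hpair]

theorem coeFn_applyL_derivAlong (ξ ζ : Lp X ∞ unitMeasure) (u v : Lp P ∞ unitMeasure) :
    applyL unitMeasure (X × P) X (derivAlong hF (ξ, u)) (pairL X P (ζ, v)) =ᵐ[unitMeasure]
      fun t => fderiv ℝ F (ξ t, u t) (ζ t, v t) := by
  filter_upwards [coeFn_applyL (derivAlong hF (ξ, u)) (pairL X P (ζ, v)),
    coeFn_nemytskii (hF.continuous_fderiv (by simp)) (pairL X P (ξ, u)), coeFn_pairL ξ u,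
    coeFn_pairL ζ v] with t happ hnem hξu hζv
  rw [happ, derivAlong, hnem, hξu, hζv]

theorem applyL_derivFstAlong (z : Lp X ∞ unitMeasure × Lp P ∞ unitMeasure)
    (ζ : Lp X ∞ unitMeasure) :
    applyL unitMeasure X X (derivFstAlong hF z) ζ =
      applyL unitMeasure (X × P) X (derivAlong hF z) (pairL X P (ζ, 0)) := by
  apply Lp.ext
  filter_upwards [coeFn_applyL (derivFstAlong hF z) ζ,
    coeFn_nemytskii (g := fun p => fderiv ℝ F p ∘L .inl ℝ X P)
      ((hF.continuous_fderiv (by simp)).clm_comp continuous_const) (pairL X P z),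
    coeFn_pairL z.1 z.2, coeFn_applyL_derivAlong hF z.1 ζ z.2 0, Lp.coeFn_zero P ∞ unitMeasure]
    with t happ hnem hz hderiv hzero
  rw [happ, derivFstAlong, hnem, hz, hderiv, hzero]
  rfl

theorem contDiff_velocity : ContDiff ℝ ∞ (velocity hF) :=
  (contDiff_nemytskii hF).comp (pairL X P).contDiff

theorem continuous_derivFstAlong : Continuous (derivFstAlong hF) :=
  (contDiff_nemytskii ((contDiff_infty_iff_fderiv.1 hF).2.clm_comp
    contDiff_const)).continuous.comp (pairL X P).continuous

theorem hasFDerivAt_velocity (z : Lp X ∞ unitMeasure × Lp P ∞ unitMeasure) :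
    HasFDerivAt (velocity hF)
      (applyL unitMeasure (X × P) X (derivAlong hF z) ∘L pairL X P) z :=
  (hasFDerivAt_nemytskii (hF.of_le (by simp)) (pairL X P z)).comp z (pairL X P).hasFDerivAt

/-- Integrate `∂F/∂x` along the segment from `η` to `ξ`. -/
theorem exists_velocity_sub_eq_applyL (ξ η : Lp X ∞ unitMeasure) (u : Lp P ∞ unitMeasure) :
    ∃ A, velocity hF (ξ, u) - velocity hF (η, u) = applyL unitMeasure X X A (ξ - η) := by
  set A : ℝ → Lp (X →L[ℝ] X) ∞ unitMeasure := fun θ => derivFstAlong hF (η + θ • (ξ - η), u)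
  have hA : Continuous A := (continuous_derivFstAlong hF).comp (by fun_prop)
  have hderiv : ∀ θ : ℝ, HasDerivAt (fun θ : ℝ => velocity hF (η + θ • (ξ - η), u))
      (applyL unitMeasure X X (A θ) (ξ - η)) θ := by
    intro θ
    have hsegment : HasDerivAt (fun θ : ℝ => (η + θ • (ξ - η), u)) (ξ - η, 0) θ := by
      simpa only [one_smul, id_eq] using
        (((hasDerivAt_id' θ).smul_const (ξ - η)).const_add η).prodMk (hasDerivAt_const θ u)
    rw [applyL_derivFstAlong]
    exact (hasFDerivAt_velocity hF _).comp_hasDerivAt θ hsegment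
  have hcont : Continuous fun θ => applyL unitMeasure X X (A θ) (ξ - η) := by fun_prop
  refine ⟨∫ θ in (0 : ℝ)..1, A θ, ?_⟩
  calc velocity hF (ξ, u) - velocity hF (η, u)
      = ∫ θ in (0 : ℝ)..1, applyL unitMeasure X X (A θ) (ξ - η) := by
        rw [intervalIntegral.integral_eq_sub_of_hasDerivAt (fun θ _ => hderiv θ)
          (hcont.intervalIntegrable 0 1)]
        simp
    _ = applyL unitMeasure X X (∫ θ in (0 : ℝ)..1, A θ) (ξ - η) :=
        ((applyL unitMeasure X X).flip (ξ - η)).intervalIntegral_comp_comm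
          (hA.intervalIntegrable 0 1)

theorem eq_of_eq_add_volterra_velocity {c ξ η : Lp X ∞ unitMeasure} {u : Lp P ∞ unitMeasure}
    (hξ : ξ = c + volterra X (velocity hF (ξ, u)))
    (hη : η = c + volterra X (velocity hF (η, u))) : ξ = η := by
  obtain ⟨A, hA⟩ := exists_velocity_sub_eq_applyL hF ξ η u
  have hfixed : volterraMul A (ξ - η) = ξ - η := by
    rw [volterraMul, ContinuousLinearMap.comp_apply, ← hA, map_sub]
    conv_rhs => rw [hξ, hη]
    rw [add_sub_add_left_eq_sub]
  have hinj := (ContinuousLinearMap.isUnit_iff_bijective.1 (isUnit_one_sub_volterraMul A)).1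
  exact sub_eq_zero.1 (hinj ((sub_eq_zero.2 hfixed.symm).trans (map_zero _).symm))

section Solution

variable {c : Lp X ∞ unitMeasure} {S : Lp P ∞ unitMeasure → Lp X ∞ unitMeasure}
  (hS : ∀ u, S u = c + volterra X (velocity hF (S u, u)))

include hS

theorem contDiff_solution : ContDiff ℝ ∞ S := by
  refine contDiff_of_implicit (G := fun z => z.2 - (c + volterra X (velocity hF (z.2, z.1))))
    ?_ (fun u => sub_eq_zero.2 (hS u))
    (fun u η hη => eq_of_eq_add_volterra_velocity hF (sub_eq_zero.1 hη) (hS u)) fun u => ?_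
  · exact contDiff_snd.sub (contDiff_const.add ((volterra X).contDiff.comp
      ((contDiff_velocity hF).comp (contDiff_snd.prodMk contDiff_fst))))
  · have hvel := HasFDerivAt.comp (f := fun z : _ × _ => (z.2, z.1)) (u, S u)
      (hasFDerivAt_velocity hF (S u, u)) (hasFDerivAt_snd.prodMk hasFDerivAt_fst)
    refine ⟨_, hasFDerivAt_snd.sub (((volterra X).hasFDerivAt.comp _ hvel).const_add c), ?_⟩
    obtain ⟨U, hU⟩ := isUnit_one_sub_volterraMul (derivFstAlong hF (S u, u))
    refine ⟨ContinuousLinearEquiv.unitsEquiv ℝ _ U, hU.trans ?_⟩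
    ext1 ζ
    exact congrArg (fun w => ζ - volterra X w) (applyL_derivFstAlong hF (S u, u) ζ)

theorem hasFDerivAt_velocity_solution (u : Lp P ∞ unitMeasure) :
    HasFDerivAt (fun u => velocity hF (S u, u))
      (applyL unitMeasure (X × P) X (derivAlong hF (S u, u)) ∘L pairL X P ∘L
        (fderiv ℝ S u).prod (.id ℝ _)) u :=
  HasFDerivAt.comp (f := fun u => (S u, u)) u (hasFDerivAt_velocity hF (S u, u))
    (((contDiff_solution hF hS).differentiable (by simp) u).hasFDerivAt.prodMk (hasFDerivAt_id u))

theorem fderiv_solution (u v : Lp P ∞ unitMeasure) :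
    fderiv ℝ S u v = volterra X (applyL unitMeasure (X × P) X (derivAlong hF (S u, u))
      (pairL X P (fderiv ℝ S u v, v))) := by
  have hderiv := ((volterra X).hasFDerivAt.comp u
    (hasFDerivAt_velocity_solution hF hS u)).const_add c
  exact congrArg (fun L => L v) (hderiv.congr_of_eventuallyEq (Eventually.of_forall hS)).fderiv

end Solution

section Endpoint

variable {x : X}

theorem toLp_eq_add_volterra_velocity {u : Lp P ∞ unitMeasure} {ξ : ℝ → X} (h0 : ξ 0 = x)
    (hξ : IsPrimitive ξ (fun t => F (ξ t, u t))) :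
    hξ.memLp.toLp = Lp.const ∞ unitMeasure x + volterra X (velocity hF (hξ.memLp.toLp, u)) := by
  have hvel : velocity hF (hξ.memLp.toLp, u) =ᵐ[unitMeasure] fun t => F (ξ t, u t) := by
    filter_upwards [coeFn_velocity hF hξ.memLp.toLp u, hξ.memLp.coeFn_toLp] with t hvel hto
    rw [hvel, hto]
  apply Lp.ext
  filter_upwards [hξ.memLp.coeFn_toLp, coeFn_volterra (velocity hF (hξ.memLp.toLp, u)),
    Lp.coeFn_add (Lp.const ∞ unitMeasure x) (volterra X (velocity hF (hξ.memLp.toLp, u))),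
    Lp.coeFn_const ∞ unitMeasure x, ae_restrict_mem measurableSet_Icc] with t hto hvol hadd hc ht
  rw [hadd, Pi.add_apply, hvol, hc, hto, hξ.eq_add_integral t ht, h0,
    intervalIntegral_congr_ae_unitMeasure hvel (by simp) ht, Function.const_apply]

theorem apply_one_eq_add_integralL_velocity {u : Lp P ∞ unitMeasure} {ξ : ℝ → X} (h0 : ξ 0 = x)
    (hξ : IsPrimitive ξ (fun t => F (ξ t, u t))) :
    ξ 1 = x + integralL X (velocity hF (hξ.memLp.toLp, u)) := by
  rw [hξ.eq_add_integral 1 (by simp), h0, integralL_apply]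
  congr 1
  refine intervalIntegral_congr_ae_unitMeasure ?_ (by simp) (by simp)
  filter_upwards [coeFn_velocity hF hξ.memLp.toLp u, hξ.memLp.coeFn_toLp] with t hvel hto
  rw [hvel, hto]

variable {ξ : Lp P ∞ unitMeasure → ℝ → X} (h0 : ∀ u, ξ u 0 = x)
  (hξ : ∀ u, IsPrimitive (ξ u) (fun t => F (ξ u t, u t)))

include hF h0 hξ

theorem contDiff_endpoint : ContDiff ℝ ∞ fun u => ξ u 1 := by
  simp only [fun u => apply_one_eq_add_integralL_velocity hF (h0 u) (hξ u)]
  have hS := contDiff_solution hF fun u => toLp_eq_add_volterra_velocity hF (h0 u) (hξ u)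
  exact contDiff_const.add ((integralL X).contDiff.comp
    ((contDiff_velocity hF).comp (hS.prodMk contDiff_id)))

theorem exists_hasFDerivAt_endpoint (u : Lp P ∞ unitMeasure) :
    ∃ L : Lp P ∞ unitMeasure →L[ℝ] X, HasFDerivAt (fun u => ξ u 1) L u ∧ ∀ v, ∃ z : ℝ → X,
      z 0 = 0 ∧ IsPrimitive z (fun t => fderiv ℝ F (ξ u t, u t) (z t, v t)) ∧ z 1 = L v := by
  have hS := fun u => toLp_eq_add_volterra_velocity hF (h0 u) (hξ u)
  set S : Lp P ∞ unitMeasure → Lp X ∞ unitMeasure := fun u => (hξ u).memLp.toLp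
  have hL := ((integralL X).hasFDerivAt.comp u
    (hasFDerivAt_velocity_solution hF hS u)).const_add x
  refine ⟨_, hL.congr_of_eventuallyEq (Eventually.of_forall fun u =>
    apply_one_eq_add_integralL_velocity hF (h0 u) (hξ u)), fun v => ?_⟩
  set k := applyL unitMeasure (X × P) X (derivAlong hF (S u, u)) (pairL X P (fderiv ℝ S u v, v))
  refine ⟨fun t => ∫ s in (0 : ℝ)..t, k s, intervalIntegral.integral_same,
    (isPrimitive_integral (Lp.memLp k)).congr_deriv_ae ?_, (integralL_apply k).symm⟩
  have hk : fderiv ℝ S u v = volterra X k := fderiv_solution hF hS u v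
  filter_upwards [coeFn_applyL_derivAlong hF (S u) (fderiv ℝ S u v) u v, coeFn_volterra k,
    (hξ u).memLp.coeFn_toLp] with t happ hvol hto
  rw [happ, hk, hvol, hto]

end Endpoint

end SolutionMap

section LevelSet

variable {X Y : Type*} [NormedAddCommGroup X] [NormedSpace ℝ X]
  [NormedAddCommGroup Y] [NormedSpace ℝ Y]

theorem tangentAt_levelSet_subset {g : X → Y} {L : X →L[ℝ] Y} {u : X} {y : Y}
    (hg : HasFDerivAt g L u) : tangentAt {w | g w = y} u ⊆ {v | L v = 0} := by
  rintro v ⟨γ, rfl, -, hγ, hγS⟩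
  exact (hg.comp_hasDerivAt 0 hγ).unique
    ((hasDerivAt_const (0 : ℝ) y).congr_of_eventuallyEq hγS)

variable [CompleteSpace X]

theorem exists_openPartialHomeomorph_contDiffOn_symm {ψ : X → Y} {e : X ≃L[ℝ] Y} {u : X}
    (hψ : ContDiff ℝ ∞ ψ) (he : HasFDerivAt ψ (e : X →L[ℝ] Y) u) :
    ∃ χ : OpenPartialHomeomorph X Y,
      χ = ψ ∧ u ∈ χ.source ∧ ContDiffOn ℝ ∞ χ.symm χ.target := by
  have hopen : IsOpen {w | fderiv ℝ ψ w ∈ range ((↑) : (X ≃L[ℝ] Y) → X →L[ℝ] Y)} :=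
    ContinuousLinearEquiv.isOpen.preimage (hψ.continuous_fderiv (by simp))
  set χ := (hψ.contDiffAt.toOpenPartialHomeomorph ψ he (by simp)).restrOpen _ hopen
  refine ⟨χ, rfl, ⟨ContDiffAt.mem_toOpenPartialHomeomorph_source _ _ _, e, he.fderiv.symm⟩,
    fun z hz => ?_⟩
  obtain ⟨-, e', he'⟩ := χ.map_target hz
  refine (χ.contDiffAt_symm (f₀' := e') hz ?_ hψ.contDiffAt).contDiffWithinAt
  rw [he']
  exact (hψ.differentiable (by simp) (χ.symm z)).hasFDerivAt

variable {g : X → Y} {L : X →L[ℝ] Y} {u : X}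

theorem exists_chart_of_rightInverse (hg : ContDiff ℝ ∞ g) (hL : HasFDerivAt g L u)
    {σ : Y →L[ℝ] X} (hσ : Function.RightInverse σ L) :
    ∃ χ : OpenPartialHomeomorph X X, u ∈ χ.source ∧ ContDiff ℝ ∞ χ ∧
      ContDiffOn ℝ ∞ χ.symm χ.target ∧ HasFDerivAt χ (.id ℝ X) u ∧
      ∀ w, L (χ w) = g w - g u := by
  set ψ : X → X := fun w => w - σ (L w) + σ (g w - g u) with hψ_def
  have hψ : ContDiff ℝ ∞ ψ := (contDiff_id.sub (σ.contDiff.comp L.contDiff)).add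
    (σ.contDiff.comp (hg.sub contDiff_const))
  have hψu : HasFDerivAt ψ (.id ℝ X) u := by
    have h := ((hasFDerivAt_id u).sub (σ.hasFDerivAt.comp u L.hasFDerivAt)).add
      (σ.hasFDerivAt.comp u (hL.sub_const (g u)))
    rwa [sub_add_cancel] at h
  obtain ⟨χ, hχ, hu, hsymm⟩ :=
    exists_openPartialHomeomorph_contDiffOn_symm (e := .refl ℝ X) hψ hψu
  refine ⟨χ, hu, hχ ▸ hψ, hsymm, hχ ▸ hψu, fun w => ?_⟩
  rw [hχ, hψ_def, map_add, map_sub, hσ, hσ, sub_self, zero_add]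

theorem isSubmanifoldAt_levelSet (hg : ContDiff ℝ ∞ g) (hL : HasFDerivAt g L u)
    {σ : Y →L[ℝ] X} (hσ : Function.RightInverse σ L) : IsSubmanifoldAt {w | g w = g u} u := by
  obtain ⟨χ, hu, hχ, hsymm, -, hLχ⟩ := exists_chart_of_rightInverse hg hL hσ
  refine ⟨L.ker, χ, L.closedComplemented_ker_of_rightInverse σ hσ, hu, hχ.contDiffOn, hsymm,
    fun w _ => ?_⟩
  rw [mem_ofPred_eq, LinearMap.mem_ker, ContinuousLinearMap.coe_coe, hLχ, sub_eq_zero]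

theorem tangentAt_levelSet (hg : ContDiff ℝ ∞ g) (hL : HasFDerivAt g L u)
    {σ : Y →L[ℝ] X} (hσ : Function.RightInverse σ L) :
    tangentAt {w | g w = g u} u = {v | L v = 0} := by
  refine (tangentAt_levelSet_subset hL).antisymm fun v hv => ?_
  obtain ⟨χ, hu, -, hsymm, hχu, hLχ⟩ := exists_chart_of_rightInverse hg hL hσ
  set γ : ℝ → X := fun t => χ u + t • v
  have hγ0 : γ 0 = χ u := by simp [γ]
  have hγ : HasDerivAt γ v 0 := by
    simpa only [one_smul] using ((hasDerivAt_id' (0 : ℝ)).smul_const v).const_add (χ u)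
  have htarget : γ 0 ∈ χ.target := hγ0 ▸ χ.map_source hu
  have hsymm0 : χ.symm (γ 0) = u := by rw [hγ0, χ.left_inv hu]
  have hχsymm : HasFDerivAt χ.symm (.id ℝ X) (γ 0) :=
    χ.hasFDerivAt_symm (f' := .refl ℝ X) htarget (hsymm0 ▸ hχu)
  have hLγ : ∀ t, L (γ t) = 0 := fun t => by
    rw [map_add, map_smul, hLχ, sub_self, show L v = 0 from hv, smul_zero, add_zero]
  refine ⟨χ.symm ∘ γ, hsymm0, ?_, hχsymm.comp_hasDerivAt 0 hγ, ?_⟩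
  · exact ((hsymm.contDiffAt (χ.open_target.mem_nhds htarget)).of_le (by simp)).comp 0
      (by fun_prop)
  · filter_upwards [hγ.continuousAt.eventually_mem (χ.open_target.mem_nhds htarget)] with t ht
    rw [← sub_eq_zero, Function.comp_apply, ← hLχ, χ.right_inv ht, hLγ]

end LevelSet

section Flow

variable {n p : ℕ} {f : Eu n → Eu p → Eu n} {u v : Control p} {x : Eu n} {t τ : ℝ}

theorem isTrajectory_flow (hflow : HasFlow f) (u : Control p) (x : Eu n) :
    IsTrajectory f u x (flow f u x) :=
  Classical.epsilon_spec (hflow u x)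

theorem flow_zero (hflow : HasFlow f) (u : Control p) (x : Eu n) : flow f u x 0 = x := by
  rw [(isTrajectory_flow hflow u x).2 0 (by simp), intervalIntegral.integral_same, add_zero]

theorem isPrimitive_flow (hf : Continuous fun z : Eu n × Eu p => f z.1 z.2) (hflow : HasFlow f)
    (u : Control p) (x : Eu n) :
    IsPrimitive (flow f u x) (fun t => f (flow f u x t) (u t)) := by
  obtain ⟨hcont, heq⟩ := isTrajectory_flow hflow u x
  exact ⟨memLp_top_comp_of_continuous hf (memLp_top_prodMk hcont u), fun t ht => by
    rw [flow_zero hflow, heq t ht]⟩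

theorem linA_eq_fderiv_comp_inl (hf : Differentiable ℝ fun z : Eu n × Eu p => f z.1 z.2)
    (u : Control p) (x : Eu n) (t : ℝ) :
    linA f u x t =
      fderiv ℝ (fun z : Eu n × Eu p => f z.1 z.2) (flow f u x t, u t) ∘L .inl ℝ _ _ :=
  ((hf _).hasFDerivAt.comp (f := fun a => (a, u t)) _ (hasFDerivAt_prodMk_left _ _)).fderiv

theorem linB_eq_fderiv_comp_inr (hf : Differentiable ℝ fun z : Eu n × Eu p => f z.1 z.2)
    (u : Control p) (x : Eu n) (t : ℝ) :
    linB f u x t =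
      fderiv ℝ (fun z : Eu n × Eu p => f z.1 z.2) (flow f u x t, u t) ∘L .inr ℝ _ _ :=
  ((hf _).hasFDerivAt.comp (f := fun c => (flow f u x t, c)) _
    (hasFDerivAt_prodMk_right _ _)).fderiv

theorem linA_add_linB (hf : Differentiable ℝ fun z : Eu n × Eu p => f z.1 z.2)
    (u : Control p) (x : Eu n) (t : ℝ) (a : Eu n) (c : Eu p) :
    linA f u x t a + linB f u x t c =
      fderiv ℝ (fun z : Eu n × Eu p => f z.1 z.2) (flow f u x t, u t) (a, c) := by
  rw [linA_eq_fderiv_comp_inl hf, linB_eq_fderiv_comp_inr hf]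
  simp [← map_add]

section Linearization

variable (hf : ContDiff ℝ 1 fun z : Eu n × Eu p => f z.1 z.2) (hflow : HasFlow f)

include hf hflow

theorem memLp_fderiv_flow (u : Control p) (x : Eu n) :
    MemLp (fun t => fderiv ℝ (fun z : Eu n × Eu p => f z.1 z.2) (flow f u x t, u t)) ∞
      unitMeasure :=
  memLp_top_comp_of_continuous (hf.continuous_fderiv one_ne_zero)
    (memLp_top_prodMk (isTrajectory_flow hflow u x).1 u)

theorem memLp_linA (u : Control p) (x : Eu n) : MemLp (linA f u x) ∞ unitMeasure := by
  rw [funext (linA_eq_fderiv_comp_inl (hf.differentiable one_ne_zero) u x)]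
  exact ((ContinuousLinearMap.compL ℝ (Eu n) (Eu n × Eu p) (Eu n)).flip
    (.inl ℝ _ _)).comp_memLp' (memLp_fderiv_flow hf hflow u x)

theorem IsTransition.isPrimitive {Ψ : ℝ → Eu n →L[ℝ] Eu n} (h : IsTransition f u x τ Ψ)
    (hτ : τ ∈ Icc (0 : ℝ) 1) : IsPrimitive Ψ (fun t => linA f u x t ∘L Ψ t) := by
  have hmem : MemLp (fun t => linA f u x t ∘L Ψ t) ∞ unitMeasure :=
    (ContinuousLinearMap.compL ℝ (Eu n) (Eu n) (Eu n)).memLp_of_bilin ∞ (memLp_linA hf hflow u x)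
      (memLp_top_unitMeasure_of_continuousOn h.1)
  refine ⟨hmem, fun t ht => ?_⟩
  rw [h.2 t ht, h.2 0 (by simp), add_assoc, intervalIntegral.integral_add_adjacent_intervals
    (intervalIntegrable_of_memLp_top hmem hτ (by simp))
    (intervalIntegrable_of_memLp_top hmem (by simp) ht)]

theorem IsLinTrajectory.isPrimitive {z₀ : Eu n} {z : ℝ → Eu n}
    (h : IsLinTrajectory f u x v z₀ z) :
    IsPrimitive z (fun t => linA f u x t (z t) + linB f u x t (v t)) := by
  refine ⟨?_, fun t ht => ?_⟩
  · simp only [linA_add_linB (hf.differentiable one_ne_zero)]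
    exact (ContinuousLinearMap.id ℝ (Eu n × Eu p →L[ℝ] Eu n)).memLp_of_bilin ∞
      (memLp_fderiv_flow hf hflow u x) (memLp_top_prodMk h.1 v)
  · rw [h.2 t ht, h.2 0 (by simp), intervalIntegral.integral_same, add_zero]

end Linearization

theorem isTransition_of_isPrimitive {Ψ : ℝ → Eu n →L[ℝ] Eu n}
    (hΨ : IsPrimitive Ψ (fun t => linA f u x t ∘L Ψ t)) (hτ : τ ∈ Icc (0 : ℝ) 1)
    (hid : Ψ τ = .id ℝ (Eu n)) : IsTransition f u x τ Ψ :=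
  ⟨hΨ.continuousOn, fun t ht => by rw [← hid, ← hΨ.sub_eq_integral hτ ht, add_sub_cancel]⟩

theorem transition_eq_comp (hf : ContDiff ℝ 1 fun z : Eu n × Eu p => f z.1 z.2)
    (hflow : HasFlow f) {Φ Θ : ℝ → Eu n →L[ℝ] Eu n}
    (h : IsFundamentalPair (linA f u x) Φ Θ) (ht : t ∈ Icc (0 : ℝ) 1) (hτ : τ ∈ Icc (0 : ℝ) 1) :
    transition f u x t τ = Φ t ∘L Θ τ := by
  have hexists : IsTransition f u x τ fun t => Φ t ∘L Θ τ := by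
    refine isTransition_of_isPrimitive ?_ hτ (h.comp_eq_id τ hτ)
    exact h.isPrimitive_left.clm_comp
      ((ContinuousLinearMap.compL ℝ (Eu n) (Eu n) (Eu n)).flip (Θ τ))
  have hspec : IsTransition f u x τ (transition f u x · τ) :=
    Classical.epsilon_spec (p := IsTransition f u x τ) ⟨_, hexists⟩
  have hid : transition f u x τ τ = .id ℝ (Eu n) := by
    simpa using hspec.2 τ hτ
  rw [h.eq_comp_of_isPrimitive (hspec.isPrimitive hf hflow hτ) ht hτ, hid,
    ContinuousLinearMap.comp_id]

theorem linEndpoint_eq_apply_one (hf : ContDiff ℝ 1 fun z : Eu n × Eu p => f z.1 z.2)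
    (hflow : HasFlow f) {z : ℝ → Eu n} (h0 : z 0 = 0)
    (hz : IsPrimitive z (fun t => linA f u x t (z t) + linB f u x t (v t))) :
    linEndpoint f u x v = z 1 := by
  obtain ⟨Φ, Θ, h⟩ := exists_isFundamentalPair (memLp_linA hf hflow u x)
  rw [h.variation_of_constants hz (t := 1) (by simp), h0, map_zero, map_zero, zero_add, linEndpoint]
  refine intervalIntegral.integral_congr fun τ hτ => ?_
  rw [uIcc_of_le zero_le_one] at hτ
  exact congrArg (· (linB f u x τ (v τ))) (transition_eq_comp hf hflow h (t := 1) (by simp) hτ)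

theorem linEndpoint_surjective (hf : ContDiff ℝ 1 fun z : Eu n × Eu p => f z.1 z.2)
    (hflow : HasFlow f) (hc : LinControllable f u x) :
    Function.Surjective (linEndpoint f u x) := by
  intro z₁
  obtain ⟨v, z, hz, rfl⟩ := hc 0 z₁
  have h0 : z 0 = 0 := by rw [hz.2 0 (by simp), intervalIntegral.integral_same, add_zero]
  exact ⟨v, linEndpoint_eq_apply_one hf hflow h0 (hz.isPrimitive hf hflow)⟩

theorem contDiff_flow_one (hf : ContDiff ℝ ∞ fun z : Eu n × Eu p => f z.1 z.2)
    (hflow : HasFlow f) (x : Eu n) : ContDiff ℝ ∞ fun u : Control p => flow f u x 1 :=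
  contDiff_endpoint hf (fun u => flow_zero hflow u x)
    fun u => isPrimitive_flow hf.continuous hflow u x

theorem exists_hasFDerivAt_flow_one (hf : ContDiff ℝ ∞ fun z : Eu n × Eu p => f z.1 z.2)
    (hflow : HasFlow f) (x : Eu n) (u : Control p) :
    ∃ L : Control p →L[ℝ] Eu n, HasFDerivAt (fun u : Control p => flow f u x 1) L u ∧
      ⇑L = linEndpoint f u x := by
  obtain ⟨L, hL, hLz⟩ := exists_hasFDerivAt_endpoint hf (fun u => flow_zero hflow u x)
    (fun u => isPrimitive_flow hf.continuous hflow u x) u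
  refine ⟨L, hL, funext fun v => ?_⟩
  obtain ⟨z, h0, hz, hz1⟩ := hLz v
  simp only [← linA_add_linB (hf.differentiable (by simp))] at hz
  rw [← hz1, linEndpoint_eq_apply_one (hf.of_le (by simp)) hflow h0 hz]

end Flow

section ControlSet

variable {n p m : ℕ} {f : Eu n → Eu p → Eu n} {R : Eu n →L[ℝ] Eu m} {u : Control p}
  (hf : ContDiff ℝ ∞ fun z : Eu n × Eu p => f z.1 z.2) (hflow : HasFlow f)

include hf hflow

theorem tangentAt_controlSet_subset (x : Eu n) (y : Eu m) :
    tangentAt (controlSet f R x y) u ⊆ linKer f R u x := by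
  obtain ⟨L, hL, hLlin⟩ := exists_hasFDerivAt_flow_one hf hflow x u
  rw [linKer, ← hLlin]
  exact tangentAt_levelSet_subset (R.hasFDerivAt.comp u hL)

theorem isSubmanifoldAt_iInter_controlSet {ι : Type*} [Finite ι] {x : ι → Eu n} {y : ι → Eu m}
    (hu : u ∈ ⋂ i, controlSet f R (x i) (y i))
    (hsurj : ∀ w : ι → Eu n, ∃ v, ∀ i, R (linEndpoint f u (x i) v) = R (w i)) :
    IsSubmanifoldAt (⋂ i, controlSet f R (x i) (y i)) u ∧
      tangentAt (⋂ i, controlSet f R (x i) (y i)) u = ⋂ i, linKer f R u (x i) := by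
  have := Fintype.ofFinite ι
  choose L hL hLlin using fun i => exists_hasFDerivAt_flow_one hf hflow (x i) u
  set g : Control p → ι → R.range := fun v i => R.rangeRestrict (flow f v (x i) 1)
  set Dg : Control p →L[ℝ] ι → R.range := .pi fun i => R.rangeRestrict ∘L L i
  have hg : ContDiff ℝ ∞ g := contDiff_pi.2 fun i =>
    R.rangeRestrict.contDiff.comp (contDiff_flow_one hf hflow (x i))
  have hDg : HasFDerivAt g Dg u := hasFDerivAt_pi.2 fun i =>
    R.rangeRestrict.hasFDerivAt.comp u (hL i)
  have hDg_surj : Function.Surjective Dg := by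
    intro w
    choose w' hw' using fun i => (w i).2
    obtain ⟨v, hv⟩ := hsurj w'
    refine ⟨v, funext fun i => Subtype.ext ?_⟩
    exact (congrArg R (congrFun (hLlin i) v)).trans ((hv i).trans (hw' i))
  obtain ⟨σ, hσ⟩ := Dg.exists_rightInverse_of_surjective (LinearMap.range_eq_top.2 hDg_surj)
  replace hσ : Function.RightInverse σ Dg := fun w => congrArg (fun T => T w) hσ
  have hlevel : ⋂ i, controlSet f R (x i) (y i) = {v | g v = g u} := by
    ext v
    simp only [mem_iInter, funext_iff, Subtype.ext_iff, mem_ofPred_eq, g] at hu ⊢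
    exact forall_congr' fun i => by rw [← show _ = y i from hu i]; rfl
  have hker : {v | Dg v = 0} = ⋂ i, linKer f R u (x i) := by
    ext v
    simp only [mem_iInter, linKer, ← hLlin, mem_ofPred_eq, funext_iff, Subtype.ext_iff]
    rfl
  rw [hlevel, ← hker]
  exact ⟨isSubmanifoldAt_levelSet hg hDg hσ, tangentAt_levelSet hg hDg hσ⟩

theorem isSubmanifoldAt_controlSet {x : Eu n} {y : Eu m} (hu : u ∈ controlSet f R x y)
    (hc : LinControllable f u x) :
    IsSubmanifoldAt (controlSet f R x y) u ∧
      tangentAt (controlSet f R x y) u = linKer f R u x := by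
  simpa only [iInter_const] using isSubmanifoldAt_iInter_controlSet hf hflow (ι := Unit)
    (x := fun _ => x) (y := fun _ => y) (mem_iInter.2 fun _ => hu) fun w =>
      (linEndpoint_surjective (hf.of_le (by simp)) hflow hc (w ())).imp
        fun _ hv _ => congrArg R hv

section Transversal

variable {q : ℕ} {x : Fin q → Eu n}
  (htrans : IntersectTransversally fun i => controlSet f R (x i) (R (flow f u (x i) 1)))

include htrans

theorem exists_separating_variation {i : Fin q} (hc : LinControllable f u (x i)) (w : Eu n) :
    ∃ b, R (linEndpoint f u (x i) b) = R w ∧ ∀ l ≠ i, R (linEndpoint f u (x l) b) = 0 := by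
  obtain ⟨v, rfl⟩ := linEndpoint_surjective (hf.of_le (by simp)) hflow hc w
  obtain ⟨a, ha, b, hb, rfl⟩ := htrans u (mem_iInter.2 fun _ => rfl) i v
  have ha0 : R (linEndpoint f u (x i) a) = 0 := tangentAt_controlSet_subset hf hflow _ _ ha
  refine ⟨b, ?_, fun l hl => tangentAt_controlSet_subset hf hflow _ _ (mem_iInter₂.1 hb l hl)⟩
  obtain ⟨L, -, hLlin⟩ := exists_hasFDerivAt_flow_one hf hflow (x i) u
  rw [← hLlin] at ha0 ⊢
  rw [map_add, map_add, ha0, zero_add]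

theorem exists_variation_of_transversal {s : Set (Fin q)}
    (hc : ∀ i ∈ s, LinControllable f u (x i)) (w : s → Eu n) :
    ∃ v, ∀ i : s, R (linEndpoint f u (x i) v) = R (w i) := by
  classical
  choose L hLlin using fun i =>
    (exists_hasFDerivAt_flow_one hf hflow (x i) u).imp fun _ h => h.2
  choose b hb hb0 using fun i : s => exists_separating_variation hf hflow htrans (hc i i.2) (w i)
  refine ⟨∑ i, b i, fun l => ?_⟩
  rw [← hb l, ← hLlin, map_sum, map_sum, Finset.sum_eq_single l _ (by simp)]
  intro i _ hil
  rw [hLlin, hb0 i l fun h => hil (Subtype.ext h).symm]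

end Transversal

end ControlSet

end NeuralODE

theorem mainTheorem3_general {n p m q : ℕ}
    (f : NeuralODE.Eu n → NeuralODE.Eu p → NeuralODE.Eu n)
    (hf : ContDiff ℝ ∞ (fun z : NeuralODE.Eu n × NeuralODE.Eu p => f z.1 z.2))
    (hflow : NeuralODE.HasFlow f) (R : NeuralODE.Eu n →L[ℝ] NeuralODE.Eu m)
    (x : Fin q → NeuralODE.Eu n) (y : Fin q → NeuralODE.Eu m)
    (hlcp : ∀ i, NeuralODE.LCP f R (x i) (y i))
    (htrans : ∀ y' : Fin q → NeuralODE.Eu m,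
      NeuralODE.IntersectTransversally fun i => NeuralODE.controlSet f R (x i) (y' i)) :
    (∀ i, ∀ u ∈ NeuralODE.controlSet f R (x i) (y i),
      NeuralODE.IsSubmanifoldAt (NeuralODE.controlSet f R (x i) (y i)) u ∧
      NeuralODE.tangentAt (NeuralODE.controlSet f R (x i) (y i)) u =
        NeuralODE.linKer f R u (x i)) ∧
    (∀ s : Set (Fin q), ∀ u ∈ ⋂ i ∈ s, NeuralODE.controlSet f R (x i) (y i),
      NeuralODE.IsSubmanifoldAt (⋂ i ∈ s, NeuralODE.controlSet f R (x i) (y i)) u ∧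
      NeuralODE.tangentAt (⋂ i ∈ s, NeuralODE.controlSet f R (x i) (y i)) u =
        ⋂ i ∈ s, NeuralODE.linKer f R u (x i)) := by
  refine ⟨fun i u hu => NeuralODE.isSubmanifoldAt_controlSet hf hflow hu (hlcp i u hu),
    fun s u hu => ?_⟩
  have hc : ∀ i ∈ s, NeuralODE.LinControllable f u (x i) := fun i hi =>
    hlcp i u (mem_iInter₂.1 hu i hi)
  simp only [biInter_eq_iInter] at hu ⊢
  exact NeuralODE.isSubmanifoldAt_iInter_controlSet hf hflow hu
    (NeuralODE.exists_variation_of_transversal hf hflow (htrans _) hc)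

theorem mainTheorem3 {n p m q : ℕ}
    (f : NeuralODE.Eu n → NeuralODE.Eu p → NeuralODE.Eu n)
    (hf : ContDiff ℝ ∞ (fun z : NeuralODE.Eu n × NeuralODE.Eu p => f z.1 z.2))
    (hflow : NeuralODE.HasFlow f)
    (R : NeuralODE.Eu n →L[ℝ] NeuralODE.Eu m) (hR : Function.Surjective R)
    (x : Fin q → NeuralODE.Eu n) (y : Fin q → NeuralODE.Eu m) (hx : Function.Injective x)
    (hbracket : NeuralODE.FoldedBracketGenerating f q)
    (hlcp : ∀ i, NeuralODE.LCP f R (x i) (y i))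
    (hstrong : NeuralODE.StrongMemorization f R q) :
    (∀ i : Fin q, ∀ u ∈ NeuralODE.controlSet f R (x i) (y i),
      NeuralODE.IsSubmanifoldAt (NeuralODE.controlSet f R (x i) (y i)) u ∧
      NeuralODE.tangentAt (NeuralODE.controlSet f R (x i) (y i)) u =
        NeuralODE.linKer f R u (x i)) ∧
    (∀ j ≤ q, ∀ u ∈ ⋂ i ∈ {i : Fin q | (i : ℕ) < j}, NeuralODE.controlSet f R (x i) (y i),
      NeuralODE.IsSubmanifoldAt
        (⋂ i ∈ {i : Fin q | (i : ℕ) < j}, NeuralODE.controlSet f R (x i) (y i)) u ∧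
      NeuralODE.tangentAt
        (⋂ i ∈ {i : Fin q | (i : ℕ) < j}, NeuralODE.controlSet f R (x i) (y i)) u =
          ⋂ i ∈ {i : Fin q | (i : ℕ) < j}, NeuralODE.linKer f R u (x i)) := by
  have h := mainTheorem3_general f hf hflow R x y hlcp fun y' => (hstrong x y' hx).2
  exact ⟨h.1, fun j _ => h.2 {i | (i : ℕ) < j}⟩
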